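/- For $n\ge 1$, consider games played by two players, Alice and Bob, who alternate turns and play $n$ moves each; at every turn the player to move chooses one of two possible moves, labelled $1$ and $2$. For a given player, "the whole history matters" means that the ordered sequence of all $n$ moves of this player is recorded, and "only the counts matter" means that only the number of times this player has played each of the two moves is recorded. The pair formed by what has been recorded of Alice's moves and of Bob's moves up to the present time is the state of the game, and the state after all $2n$ moves is the outcome. In the games $\mathrm{aB}_n(p)$ and $\mathrm{ab}_n(p)$ Alice makes the first move; only the counts matter for Alice, while for Bob the whole history matters in $\mathrm{aB}_n(p)$ and only the counts matter in $\mathrm{ab}_n(p)$. In the games $\mathrm{Ab}'_n(p)$ and $\mathrm{ab}'_n(p)$ Bob makes the first move; only the counts matter for Bob, while for Alice the whole history matters in $\mathrm{Ab}'_n(p)$ and only the counts matter in $\mathrm{ab}'_n(p)$. In each game, independently for each possible outcome, Bob is declared the winner with probability $p\in[0,1]$ and Alice with probability $1-p$. Given this assignment of winners, a strategy of a player is a function that assigns to each non-final state in which it is this player's turn one of the two moves, and a strategy is winning if the player using it wins the outcome that is reached, whatever strategy the opponent uses. Let $P^{\mathrm{aB}}_n(p)$ and $P^{\mathrm{ab}}_n(p)$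 denote the probabilities that Bob has a winning strategy in $\mathrm{aB}_n(p)$ and $\mathrm{ab}_n(p)$, respectively. **Proposition (Peierls estimates if Bob starts).** For all $n\ge 1$ and $p\in[0,1]$, the probability that Alice has a winning strategy in the game $\mathrm{Ab}'_n(p)$ is at most $$\sum_{m=n}^{\infty}2^{4m}(1-p)^{m+1},$$ and the probability that Alice has a winning strategy in the game $\mathrm{ab}'_n(p)$ is at most $$\sum_{m=n}^{\infty}2^{6m}(1-p)^{m+1},$$ where a divergent series has the value $+\infty$. As a result, $$P^{\mathrm{aB}}_n(p)\xrightarrow[n\to\infty]{}0\quad\text{for all }0\le p<\tfrac1{16}\qquad\text{and}\qquad P^{\mathrm{ab}}_n(p)\xrightarrow[n\to\infty]{}0\quad\text{for all }0\le p<\tfrac1{64}.$$ -/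

import Mathlib

open Filter Topology MeasureTheory
open scoped ENNReal

/-- The two players of a turn-based game. -/
inductive Player where
  | alice
  | bob

/-- The opponent of a player. -/
def Player.other : Player → Player
  | .alice => .bob
  | .bob => .alice

/-- A game-graph: a finite directed graph without directed cycles (or loops) of states of the game with a root (the initial
state) from which every state can be reached, together with a function telling whose turn it is.
The value of `turn` at a state without outgoing edges plays no role. -/
structure GameGraph where
  V : Type
  Edge : V → V → Prop
  root : V
  turn : V → Player
  finite : Finite V
  acyclic : ∀ v, ¬ Relation.TransGen Edge v v
  reachable : ∀ v, Relation.ReflTransGen Edge root v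

namespace GameGraph

/-- A state is non-final if at least one move is possible in it. -/
def NonFinal (G : GameGraph) (v : G.V) : Prop := ∃ w, G.Edge v w

/-- The possible outcomes of the game: the states without outgoing edges. -/
def Outcome (G : GameGraph) : Type := {v : G.V // ¬ G.NonFinal v}

/-- A (pure) strategy of a player assigns to each non-final state in which it is this player's
turn one of the possible next states. -/
def Strategy (G : GameGraph) (i : Player) : Type :=
  (v : {v : G.V // G.NonFinal v ∧ G.turn v = i}) → {w : G.V // G.Edge v.1 w}

open Classical in
/-- The state following `v` if Alice plays `σ₁` and Bob plays `σ₂`; final states are kept. -/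
noncomputable def next (G : GameGraph) (σ₁ : G.Strategy .alice) (σ₂ : G.Strategy .bob)
    (v : G.V) : G.V :=
  if h₁ : G.NonFinal v ∧ G.turn v = .alice then (σ₁ ⟨v, h₁⟩).1
  else if h₂ : G.NonFinal v ∧ G.turn v = .bob then (σ₂ ⟨v, h₂⟩).1
  else v

/-- The state of the game after `k` moves (frozen once a final state has been reached). -/
noncomputable def play (G : GameGraph) (σ₁ : G.Strategy .alice) (σ₂ : G.Strategy .bob) :
    ℕ → G.V
  | 0 => G.root
  | k + 1 => G.next σ₁ σ₂ (play G σ₁ σ₂ k)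

theorem edge_next (G : GameGraph) (σ₁ : G.Strategy .alice) (σ₂ : G.Strategy .bob) (v : G.V)
    (hv : G.NonFinal v) : G.Edge v (G.next σ₁ σ₂ v) := by
  unfold next
  split_ifs with h₁ h₂
  · exact (σ₁ ⟨v, h₁⟩).2
  · exact (σ₂ ⟨v, h₂⟩).2
  · cases h : G.turn v
    · exact absurd ⟨hv, h⟩ h₁
    · exact absurd ⟨hv, h⟩ h₂

theorem exists_play_final (G : GameGraph) (σ₁ : G.Strategy .alice) (σ₂ : G.Strategy .bob) :
    ∃ k, ¬ G.NonFinal (G.play σ₁ σ₂ k) := by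
  by_contra! hcon
  have hstep : ∀ k, G.Edge (G.play σ₁ σ₂ k) (G.play σ₁ σ₂ (k + 1)) := fun k =>
    G.edge_next σ₁ σ₂ _ (hcon k)
  have htrans : ∀ i d, Relation.TransGen G.Edge (G.play σ₁ σ₂ i) (G.play σ₁ σ₂ (i + d + 1)) := by
    intro i d
    induction d with
    | zero => exact .single (hstep i)
    | succ d ih => exact ih.tail (hstep (i + d + 1))
  have := G.finite
  obtain ⟨i, j, hij, he⟩ := Finite.exists_ne_map_eq_of_infinite (G.play σ₁ σ₂)
  have key : ∀ i j, i < j → G.play σ₁ σ₂ i = G.play σ₁ σ₂ j → False := by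
    intro i j hlt he
    obtain ⟨d, rfl⟩ := Nat.exists_eq_add_of_lt hlt
    have := htrans i d
    rw [← he] at this
    exact G.acyclic _ this
  rcases lt_or_gt_of_ne hij with h | h
  · exact key i j h he
  · exact key j i h he.symm

open Classical in
/-- The outcome of the game if Alice plays `σ₁` and Bob plays `σ₂`: the first final state that
the play reaches. -/
noncomputable def outcome (G : GameGraph) (σ₁ : G.Strategy .alice) (σ₂ : G.Strategy .bob) :
    G.Outcome :=
  ⟨G.play σ₁ σ₂ (Nat.find (G.exists_play_final σ₁ σ₂)),
    Nat.find_spec (G.exists_play_final σ₁ σ₂)⟩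

/-- Alice has a winning strategy, given the assignment `x` of winners to outcomes; here
`x v = false` means that Alice wins in `v` and `x v = true` that Bob wins in `v`. -/
def AliceWins (G : GameGraph) (x : G.Outcome → Bool) : Prop :=
  ∃ σ₁ : G.Strategy .alice, ∀ σ₂ : G.Strategy .bob, x (G.outcome σ₁ σ₂) = false

/-- Bob has a winning strategy, given the assignment `x` of winners to outcomes. -/
def BobWins (G : GameGraph) (x : G.Outcome → Bool) : Prop :=
  ∃ σ₂ : G.Strategy .bob, ∀ σ₁ : G.Strategy .alice, x (G.outcome σ₁ σ₂) = true

noncomputable instance (G : GameGraph) : Fintype G.Outcome :=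
  haveI := G.finite
  haveI : Finite G.Outcome := Subtype.finite
  Fintype.ofFinite _

/-- The joint law of i.i.d. winners, where each given outcome is a win for Bob with
probability `p`. -/
noncomputable def winnerLaw (G : GameGraph) (p : unitInterval) : Measure (G.Outcome → Bool) :=
  Measure.pi fun _ => ProbabilityTheory.bernoulliMeasure true false p

/-- The probability that Alice has a winning strategy. -/
noncomputable def probAlice (G : GameGraph) (p : unitInterval) : ℝ≥0∞ :=
  G.winnerLaw p {x | G.AliceWins x}

/-- The probability that Bob has a winning strategy. -/
noncomputable def probBob (G : GameGraph) (p : unitInterval) : ℝ≥0∞ :=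
  G.winnerLaw p {x | G.BobWins x}

end GameGraph

/-- A decision graph: a rooted directed graph in which every vertex can be reached from the root,
every edge increases the distance `level` to the root by one, and every vertex has an outgoing
edge. The conditions on `level` force it to be the graph distance to the root, since each
directed path from the root to `v` then has length `level v`. Finiteness of the number of outgoing
edges makes the games of finite length played on the graph finite. -/
structure DecisionGraph where
  V : Type
  Edge : V → V → Prop
  root : V
  level : V → ℕ
  level_root : level root = 0
  level_edge : ∀ {v w}, Edge v w → level w = level v + 1
  reachable : ∀ w, Relation.ReflTransGen Edge root w
  exists_edge : ∀ v, ∃ w, Edge v w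
  finite_out : ∀ v, {w | Edge v w}.Finite

namespace DecisionGraph

theorem level_lt_of_transGen (D : DecisionGraph) {v w : D.V}
    (h : Relation.TransGen D.Edge v w) : D.level v < D.level w := by
  induction h with
  | single h => have := D.level_edge h; omega
  | tail _ h ih => have := D.level_edge h; omega

theorem eq_root_of_level (D : DecisionGraph) {v : D.V} (h : D.level v = 0) : v = D.root := by
  rcases (Relation.ReflTransGen.cases_tail (D.reachable v)) with h' | ⟨u, _, hu⟩
  · exact h'
  · have := D.level_edge hu; omega

theorem exists_pred (D : DecisionGraph) {v : D.V} {n : ℕ} (h : D.level v = n + 1) :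
    ∃ u, D.Edge u v ∧ D.level u = n := by
  rcases (Relation.ReflTransGen.cases_tail (D.reachable v)) with h' | ⟨u, _, hu⟩
  · rw [h', D.level_root] at h; omega
  · exact ⟨u, hu, by have := D.level_edge hu; omega⟩

theorem finite_level_le (D : DecisionGraph) (n : ℕ) : {v | D.level v ≤ n}.Finite := by
  induction n with
  | zero =>
    refine (Set.finite_singleton D.root).subset fun v hv => ?_
    exact D.eq_root_of_level (Nat.le_zero.mp hv)
  | succ n ih =>
    refine (ih.union (ih.biUnion fun v _ => D.finite_out v)).subset fun v hv => ?_
    rcases Nat.lt_or_ge n (D.level v) with h | h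
    · obtain ⟨u, hu, hl⟩ := D.exists_pred (n := n) (v := v) (le_antisymm hv h)
      exact Or.inr (Set.mem_biUnion (show D.level u ≤ n from hl.le) hu)
    · exact Or.inl h

/-- The game of `N` moves in total on the decision graph `D`, played by alternating turns with the
player `first` making the first move: the states are the vertices at distance at most `N` from
the root. -/
def game (D : DecisionGraph) (first : Player) (N : ℕ) : GameGraph where
  V := {v : D.V // D.level v ≤ N}
  Edge v w := D.Edge v.1 w.1
  root := ⟨D.root, by rw [D.level_root]; exact N.zero_le⟩
  turn v := if Even (D.level v.1) then first else first.other
  finite := (D.finite_level_le N).to_subtype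
  acyclic v h := lt_irrefl _ (D.level_lt_of_transGen (h.lift Subtype.val fun _ _ h => h))
  reachable := by
    rintro ⟨v, hv⟩
    have key : ∀ w, Relation.ReflTransGen D.Edge D.root w → ∀ hw : D.level w ≤ N,
        Relation.ReflTransGen (fun a b : {v : D.V // D.level v ≤ N} => D.Edge a.1 b.1)
          ⟨D.root, by rw [D.level_root]; exact N.zero_le⟩ ⟨w, hw⟩ := by
      intro w h
      induction h with
      | refl => intro _; exact .refl
      | tail _ h ih =>
        intro hw
        have hl := D.level_edge h
        exact (ih (by omega)).tail h
    exact key v (D.reachable v) hv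

/-- The product `D₁ ⋉ D₂`: states `(a, b)` in which a move in the first coordinate and a move in
the second coordinate alternate, the first coordinate moving first. -/
def ltimes (D₁ D₂ : DecisionGraph) : DecisionGraph where
  V := {v : D₁.V × D₂.V // D₁.level v.1 = D₂.level v.2 ∨ D₁.level v.1 = D₂.level v.2 + 1}
  Edge v w :=
    (D₁.level v.1.1 = D₂.level v.1.2 ∧ D₁.Edge v.1.1 w.1.1 ∧ w.1.2 = v.1.2) ∨
    (D₁.level v.1.1 = D₂.level v.1.2 + 1 ∧ w.1.1 = v.1.1 ∧ D₂.Edge v.1.2 w.1.2)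
  root := ⟨(D₁.root, D₂.root), Or.inl (by rw [D₁.level_root, D₂.level_root])⟩
  level v := D₁.level v.1.1 + D₂.level v.1.2
  level_root := by simp only [D₁.level_root, D₂.level_root]
  level_edge := by
    rintro v w (⟨_, h, h'⟩ | ⟨_, h', h⟩)
    · rw [h', D₁.level_edge h]; omega
    · rw [h', D₂.level_edge h]; omega
  reachable := by
    have key : ∀ n, ∀ w : {v : D₁.V × D₂.V //
        D₁.level v.1 = D₂.level v.2 ∨ D₁.level v.1 = D₂.level v.2 + 1},
        D₁.level w.1.1 + D₂.level w.1.2 = n → Relation.ReflTransGen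
          (fun v w : {v : D₁.V × D₂.V //
            D₁.level v.1 = D₂.level v.2 ∨ D₁.level v.1 = D₂.level v.2 + 1} =>
            (D₁.level v.1.1 = D₂.level v.1.2 ∧ D₁.Edge v.1.1 w.1.1 ∧ w.1.2 = v.1.2) ∨
            (D₁.level v.1.1 = D₂.level v.1.2 + 1 ∧ w.1.1 = v.1.1 ∧ D₂.Edge v.1.2 w.1.2))
          ⟨(D₁.root, D₂.root), Or.inl (by rw [D₁.level_root, D₂.level_root])⟩ w := by
      intro n
      induction n with
      | zero =>
        rintro ⟨⟨a, b⟩, hab⟩ h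
        obtain rfl := D₁.eq_root_of_level (v := a) (by simp only at h; omega)
        obtain rfl := D₂.eq_root_of_level (v := b) (by simp only at h; omega)
        exact .refl
      | succ n ih =>
        rintro ⟨⟨a, b⟩, hab⟩ h
        simp only at h hab
        rcases hab with hab | hab
        · obtain ⟨b', hb, hl⟩ := D₂.exists_pred (v := b) (n := D₂.level b - 1) (by omega)
          refine (ih ⟨(a, b'), Or.inr (by simp only; omega)⟩ (by simp only; omega)).tail ?_
          exact Or.inr ⟨by simp only; omega, rfl, hb⟩
        · obtain ⟨a', ha, hl⟩ := D₁.exists_pred (v := a) (n := D₂.level b) (by omega)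
          refine (ih ⟨(a', b), Or.inl (by simp only; omega)⟩ (by simp only; omega)).tail ?_
          exact Or.inl ⟨by simp only; omega, ha, rfl⟩
    exact fun w => key _ w rfl
  exists_edge := by
    rintro ⟨⟨a, b⟩, hab | hab⟩
    · obtain ⟨a', ha⟩ := D₁.exists_edge a
      have hl := D₁.level_edge ha
      exact ⟨⟨(a', b), Or.inr (by simp only at hab ⊢; omega)⟩, Or.inl ⟨hab, ha, rfl⟩⟩
    · obtain ⟨b', hb⟩ := D₂.exists_edge b
      have hl := D₂.level_edge hb
      exact ⟨⟨(a, b'), Or.inl (by simp only at hab ⊢; omega)⟩, Or.inr ⟨hab, rfl, hb⟩⟩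
  finite_out := by
    rintro ⟨⟨a, b⟩, hab⟩
    refine Set.Finite.subset (Set.Finite.preimage Subtype.val_injective.injOn
      (((D₁.finite_out a).prod (Set.finite_singleton b)).union
        ((Set.finite_singleton a).prod (D₂.finite_out b)))) ?_
    rintro ⟨⟨a', b'⟩, h'⟩ (⟨_, h₁, h₂⟩ | ⟨_, h₁, h₂⟩)
    · exact Or.inl ⟨h₁, h₂⟩
    · exact Or.inr ⟨h₁, h₂⟩

/-- The product `D₁ ⋊ D₂ = {(a, b) : (b, a) ∈ D₂ ⋉ D₁}`, with the structure of a decision graph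
carried over from `D₂ ⋉ D₁`: now the second coordinate moves first. -/
def rtimes (D₁ D₂ : DecisionGraph) : DecisionGraph where
  V := {v : D₁.V × D₂.V // D₂.level v.2 = D₁.level v.1 ∨ D₂.level v.2 = D₁.level v.1 + 1}
  Edge v w := (D₂.ltimes D₁).Edge ⟨v.1.swap, v.2⟩ ⟨w.1.swap, w.2⟩
  root := ⟨(D₁.root, D₂.root), Or.inl (by rw [D₁.level_root, D₂.level_root])⟩
  level v := (D₂.ltimes D₁).level ⟨v.1.swap, v.2⟩
  level_root := (D₂.ltimes D₁).level_root
  level_edge h := (D₂.ltimes D₁).level_edge h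
  reachable := by
    have key : ∀ w, Relation.ReflTransGen (D₂.ltimes D₁).Edge (D₂.ltimes D₁).root w →
        Relation.ReflTransGen (fun v w : {v : D₁.V × D₂.V //
          D₂.level v.2 = D₁.level v.1 ∨ D₂.level v.2 = D₁.level v.1 + 1} =>
            (D₂.ltimes D₁).Edge ⟨v.1.swap, v.2⟩ ⟨w.1.swap, w.2⟩)
          ⟨(D₁.root, D₂.root), Or.inl (by rw [D₁.level_root, D₂.level_root])⟩
          ⟨w.1.swap, w.2⟩ := by
      intro w h
      induction h with
      | refl => exact .refl
      | tail _ h ih => exact ih.tail h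
    exact fun w => key _ ((D₂.ltimes D₁).reachable ⟨w.1.swap, w.2⟩)
  exists_edge v := by
    obtain ⟨w, hw⟩ := (D₂.ltimes D₁).exists_edge ⟨v.1.swap, v.2⟩
    exact ⟨⟨w.1.swap, w.2⟩, hw⟩
  finite_out v := by
    refine Set.Finite.preimage (f := fun w : {v : D₁.V × D₂.V //
        D₂.level v.2 = D₁.level v.1 ∨ D₂.level v.2 = D₁.level v.1 + 1} =>
        (⟨w.1.swap, w.2⟩ : (D₂.ltimes D₁).V)) ?_ ((D₂.ltimes D₁).finite_out ⟨v.1.swap, v.2⟩)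
    rintro ⟨⟨a, b⟩, h⟩ _ ⟨⟨a', b'⟩, h'⟩ _ he
    have := congrArg (fun u : (D₂.ltimes D₁).V => u.1.swap) he
    exact Subtype.ext this

/-- The binary tree of all finite words in a two-letter alphabet, where a word is extended by
appending a letter at its end: the whole history of moves is recorded. -/
def tree : DecisionGraph where
  V := List (Fin 2)
  Edge v w := ∃ k : Fin 2, w = v ++ [k]
  root := []
  level := List.length
  level_root := rfl
  level_edge := by rintro v w ⟨k, rfl⟩; simp
  reachable w := by
    induction w using List.reverseRecOn with
    | nil => exact .refl
    | append_singleton l k ih => exact ih.tail ⟨k, rfl⟩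
  exists_edge v := ⟨v ++ [0], 0, rfl⟩
  finite_out v := (Set.finite_range fun k : Fin 2 => v ++ [k]).subset
    (by rintro w ⟨k, rfl⟩; exact ⟨k, rfl⟩)

/-- The quadrant of pairs of nonnegative integers, where a move increases one of the two
coordinates by one: only the number of times each move has been played is recorded. -/
def quadrant : DecisionGraph where
  V := ℕ × ℕ
  Edge v w := w = (v.1 + 1, v.2) ∨ w = (v.1, v.2 + 1)
  root := (0, 0)
  level v := v.1 + v.2
  level_root := rfl
  level_edge := by rintro v w (rfl | rfl) <;> simp only <;> omega
  reachable := by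
    rintro ⟨i, j⟩
    induction j with
    | zero =>
      induction i with
      | zero => exact .refl
      | succ i ih => exact ih.tail (Or.inl rfl)
    | succ j ih => exact ih.tail (Or.inr rfl)
  exists_edge v := ⟨_, Or.inl rfl⟩
  finite_out v := ((Set.finite_singleton (v.1 + 1, v.2)).union
    (Set.finite_singleton (v.1, v.2 + 1))).subset (by rintro w h; exact h)

end DecisionGraph

open DecisionGraph in
/-- The game `aBₙ`: Alice starts, each player makes `n` moves; Alice's move counts and Bob's
whole history of moves determine the outcome. -/
def game_aB (n : ℕ) : GameGraph := (quadrant.ltimes tree).game .alice (2 * n)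

open DecisionGraph in
/-- The game `abₙ`: Alice starts, each player makes `n` moves; the move counts of both players
determine the outcome. -/
def game_ab (n : ℕ) : GameGraph := (quadrant.ltimes quadrant).game .alice (2 * n)

open DecisionGraph in
/-- The game `Ab'ₙ`: Bob starts, each player makes `n` moves; Alice's whole history of moves and
Bob's move counts determine the outcome. -/
def game_Ab' (n : ℕ) : GameGraph := (tree.rtimes quadrant).game .bob (2 * n)

open DecisionGraph in
/-- The game `ab'ₙ`: Bob starts, each player makes `n` moves; the move counts of both players
determine the outcome. -/
def game_ab' (n : ℕ) : GameGraph := (quadrant.rtimes quadrant).game .bob (2 * n)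

/-! This is a Peierls argument. Fix a winning strategy of the second player (Alice if Bob starts,
Bob if Alice starts). The first player can play any binary word `w` of length `n`, and the second
player's answers form a path whose first `j` steps depend only on the first `j` letters. Since only
the counts matter for the first player, the outcome is the pair of the path's end point and the
number of letters `true` in `w`; all these outcomes are won by the second player.

Run through the words in lexicographic order, as the leaves of a binary tree. Consecutive words are
`u 0 1^h` and `u 1 0^h`, so with `k = h + 1` the answer goes back `k` levels to a common ancestor
and descends `k` levels again, while the counter changes by `2 - k` (`IsResponse.reflTransGen`).
Erasing loops leaves `m + 1` distinct winning outcomes joined by `m` such steps. The counter rises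
from `0` to `n`, so the weights `k` add up to `2m - n`; each is at least `1`, hence `m ≥ n`
(`IsResponse.exists_contour`).

If the second player's decision graph has out-degree at most `2` and in-degree at most `d`, a step
of weight `k` has at most `(2d)^k` continuations, and the choice of weights costs at most another
factor `2` per unit of weight. There are thus at most `(4d)^(2m)` contours, each winning with
probability at most `q^(m+1)`, and a union bound (`measure_exists_isResponse_le`) gives the series.
The tree has `d = 1` and the quadrant `d = 2`, hence the bases `16` and `64`. The limits follow
because the bounds are tails of a convergent geometric series. -/

/-! ### Counting weighted paths -/

/-- `b` can be reached from `a` by following exactly `k` steps of the relation `r`. -/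
def StepsTo {α : Type*} (r : α → α → Prop) : ℕ → α → α → Prop
  | 0, a, b => a = b
  | k + 1, a, b => ∃ c, r a c ∧ StepsTo r k c b

/-- Every element has at most `d` successors under `r`. -/
def OutBounded {α : Type*} (r : α → α → Prop) (d : ℕ) : Prop :=
  ∀ a, ∃ s : Finset α, s.card ≤ d ∧ ∀ b, r a b → b ∈ s

theorem OutBounded.comp {α : Type*} {r s : α → α → Prop} {d e : ℕ} (hr : OutBounded r d)
    (hs : OutBounded s e) : OutBounded (fun a b => ∃ c, r a c ∧ s c b) (d * e) := by
  classical
  intro a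
  obtain ⟨A, hA, hA'⟩ := hr a
  choose S hS hS' using hs
  refine ⟨A.biUnion S, ?_, ?_⟩
  · calc (A.biUnion S).card ≤ A.card * e := Finset.card_biUnion_le_card_mul _ _ _ fun c _ => hS c
      _ ≤ d * e := Nat.mul_le_mul_right _ hA
  · rintro b ⟨c, hac, hcb⟩
    exact Finset.mem_biUnion.2 ⟨c, hA' _ hac, hS' _ _ hcb⟩

theorem OutBounded.stepsTo {α : Type*} {r : α → α → Prop} {d : ℕ} (hr : OutBounded r d) (k : ℕ) :
    OutBounded (StepsTo r k) (d ^ k) := by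
  induction k with
  | zero => exact fun a => ⟨{a}, by simp, fun b h => by simp [show a = b from h]⟩
  | succ k ih =>
    rw [pow_succ']
    exact hr.comp ih

/-- `WeightedPath R a K l` says that `a :: l` is a path whose steps carry positive weights with
sum `K`, where `R k` is the relation of a step of weight `k`. -/
inductive WeightedPath {α : Type*} (R : ℕ → α → α → Prop) : α → ℕ → List α → Prop
  | nil (a : α) : WeightedPath R a 0 []
  | cons {a b : α} {k K : ℕ} {l : List α} (hk : 1 ≤ k) (h : R k a b) (hl : WeightedPath R b K l) :
      WeightedPath R a (k + K) (b :: l)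

theorem sum_two_pow_sub_le (K : ℕ) : ∑ i ∈ Finset.range K, 2 ^ (K - (i + 1)) ≤ 2 ^ K := by
  induction K with
  | zero => simp
  | succ K ih =>
    rw [Finset.sum_range_succ']
    have : ∀ i, K + 1 - (i + 1 + 1) = K - (i + 1) := fun i => by omega
    simp only [this]
    simp only [zero_add, Nat.add_sub_cancel, pow_succ]
    omega

/-- The factor `2` per unit of weight pays for the compositions of `K` into step weights; for fixed
weights the numbers of continuations multiply to `c ^ K`. -/
theorem WeightedPath.exists_finset {α : Type*} {R : ℕ → α → α → Prop} {c : ℕ}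
    (hR : ∀ k, OutBounded (R k) (c ^ k)) (K : ℕ) (a : α) :
    ∃ T : Finset (List α), T.card ≤ (2 * c) ^ K ∧ ∀ l, WeightedPath R a K l → l ∈ T := by
  classical
  induction K using Nat.strong_induction_on generalizing a with
  | _ K ih =>
    rcases Nat.eq_zero_or_pos K with rfl | hK
    · refine ⟨{[]}, by simp, fun l hl => ?_⟩
      generalize h0 : 0 = K at hl
      cases hl with
      | nil => simp
      | cons hk _ _ => omega
    · choose T hT hT' using ih
      choose S hS hS' using hR
      -- Split according to the weight `i + 1` of the first step and its end point `b`.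
      refine ⟨(Finset.range K).biUnion fun i => (S (i + 1) a).biUnion fun b =>
        (T (K - (i + 1)) (by omega) b).image (List.cons b), ?_, ?_⟩
      · calc _ ≤ ∑ i ∈ Finset.range K, c ^ (i + 1) * (2 * c) ^ (K - (i + 1)) := by
              refine Finset.card_biUnion_le.trans (Finset.sum_le_sum fun i _ => ?_)
              refine (Finset.card_biUnion_le_card_mul _ _ _ fun b _ =>
                Finset.card_image_le.trans (hT _ _ b)).trans ?_
              exact Nat.mul_le_mul_right _ (hS _ _)
          _ = ∑ i ∈ Finset.range K, 2 ^ (K - (i + 1)) * c ^ K := by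
              refine Finset.sum_congr rfl fun i hi => ?_
              have hi := Finset.mem_range.1 hi
              obtain ⟨j, rfl⟩ : ∃ j, K = (i + 1) + j := ⟨K - (i + 1), by omega⟩
              rw [Nat.add_sub_cancel_left, mul_pow, pow_add]
              ring
          _ ≤ (2 * c) ^ K := by
              rw [← Finset.sum_mul, mul_pow]
              exact Nat.mul_le_mul_right _ (sum_two_pow_sub_le K)
      · intro l hl
        cases hl with
        | nil => omega
        | @cons _ b k K' l' hk h hl' =>
          simp only [Finset.mem_biUnion, Finset.mem_range, Finset.mem_image]
          refine ⟨k - 1, by omega, b, ?_, l', ?_, rfl⟩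
          · rw [Nat.sub_add_cancel hk]
            exact hS' _ _ _ h
          · have e : k + K' - (k - 1 + 1) = K' := by omega
            apply hT'
            rwa [e]

/-- Loop erasure: two elements connected by a relation are connected by a self-avoiding chain. -/
theorem exists_nodup_chain {α : Type*} {r : α → α → Prop} {a b : α}
    (h : Relation.ReflTransGen r a b) :
    ∃ l : List α, (a :: l).IsChain r ∧ (a :: l).getLast (by simp) = b ∧ (a :: l).Nodup := by
  induction h using Relation.ReflTransGen.head_induction_on with
  | refl => exact ⟨[], by simp⟩
  | @head a c hac _ ih =>
    obtain ⟨l, hl, hb, hn⟩ := ih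
    by_cases ha : a ∈ c :: l
    -- If `a` is visited again later, the loop before that visit is discarded.
    · obtain ⟨s, t, hst⟩ := List.append_of_mem ha
      refine ⟨t, ?_, ?_, ?_⟩
      · rw [hst] at hl
        exact hl.right_of_append
      · simp only [hst] at hb
        rw [← hb, List.getLast_append_of_ne_nil]
      · rw [hst] at hn
        exact hn.of_append_right
    · exact ⟨c :: l, List.isChain_cons_cons.2 ⟨hac, hl⟩, by simpa using hb,
        List.nodup_cons.2 ⟨ha, hn⟩⟩

/-! ### Contours -/

/-- A contour step: backtrack `k` levels to a common ancestor and descend `k` levels again, while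
the counter changes by `2 - k`. -/
def ContourStep {α : Type*} (r : α → α → Prop) (k : ℕ) (o o' : α × ℕ) : Prop :=
  (∃ c, StepsTo (flip r) k o.1 c ∧ StepsTo r k c o'.1) ∧ o'.2 + k = o.2 + 2

/-- Each of the `k` steps back has at most `d` choices and each of the `k` steps forward at most
`2`; the new counter is forced by `k`. -/
theorem outBounded_contourStep {α : Type*} {r : α → α → Prop} {d : ℕ} (hr : OutBounded r 2)
    (hr' : OutBounded (flip r) d) (k : ℕ) : OutBounded (ContourStep r k) ((d * 2) ^ k) := by
  intro o
  obtain ⟨s, hs, hs'⟩ := ((hr'.stepsTo k).comp (hr.stepsTo k)) o.1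
  refine ⟨s.map ⟨fun a => (a, o.2 + 2 - k), fun a b h => (Prod.ext_iff.1 h).1⟩, ?_, ?_⟩
  · rwa [Finset.card_map, mul_pow]
  · rintro ⟨a, j⟩ ⟨h, hj⟩
    refine Finset.mem_map.2 ⟨a, hs' _ h, Prod.ext rfl ?_⟩
    have hj : j + k = o.2 + 2 := hj
    exact show o.2 + 2 - k = j by omega

/-- Summing the counter changes `2 - k` along the chain ties the total weight to the number of
steps. -/
theorem exists_weightedPath_of_isChain {α : Type*} {r : α → α → Prop} {W : α × ℕ → Prop}
    (l : List (α × ℕ)) : ∀ o, (o :: l).IsChain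
      (fun o o' => (∃ k, 1 ≤ k ∧ ContourStep r k o o') ∧ W o') →
    ∃ K, WeightedPath (ContourStep r) o K l ∧ l.length ≤ K ∧
      ((o :: l).getLast (by simp)).2 + K = o.2 + 2 * l.length ∧ ∀ o' ∈ l, W o' := by
  induction l with
  | nil => exact fun o _ => ⟨0, .nil o, by simp⟩
  | cons b l ih =>
    intro o h
    obtain ⟨⟨⟨k, hk, hs⟩, hW⟩, h⟩ := List.isChain_cons_cons.1 h
    obtain ⟨K, hK, hle, hlast, hall⟩ := ih b h
    refine ⟨k + K, .cons hk hs hK, by simp only [List.length_cons]; omega, ?_, ?_⟩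
    · rw [List.getLast_cons_cons, List.length_cons]
      have := hs.2
      omega
    · simp only [List.mem_cons, forall_eq_or_imp]
      exact ⟨hW, hall⟩

/-! ### Words of the first player and the responses to them -/

/-- The word that agrees with `w` in the first `j` letters and is constant from there on. -/
def wordTail (w : ℕ → Bool) (j : ℕ) (b : Bool) (i : ℕ) : Bool := if i < j then w i else b

/-- The number of letters `true` among the first `n` letters of a word. -/
def wordCount (n : ℕ) (w : ℕ → Bool) : ℕ := ∑ i ∈ Finset.range n, (w i).toNat

theorem wordCount_succ (n : ℕ) (w : ℕ → Bool) :
    wordCount (n + 1) w = wordCount n w + (w n).toNat := Finset.sum_range_succ _ _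

theorem wordCount_congr {n : ℕ} {w w' : ℕ → Bool} (h : ∀ i < n, w i = w' i) :
    wordCount n w = wordCount n w' :=
  Finset.sum_congr rfl fun i hi => by rw [h i (Finset.mem_range.1 hi)]

theorem wordCount_wordTail (w : ℕ → Bool) (j h : ℕ) (b : Bool) :
    wordCount (j + h) (wordTail w j b) = wordCount j w + h * b.toNat := by
  induction h with
  | zero =>
    simp only [add_zero, zero_mul]
    exact wordCount_congr fun i hi => by simp [wordTail, hi]
  | succ h ih =>
    rw [← add_assoc, wordCount_succ, ih]
    simp only [wordTail, show ¬ (j + h < j) by omega, if_false]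
    ring

theorem wordTail_wordTail (w : ℕ → Bool) (j : ℕ) (b : Bool) :
    wordTail (wordTail w j b) (j + 1) b = wordTail w j b := by
  funext i
  simp only [wordTail]
  split_ifs <;> first | rfl | omega

/-- The responses `a w` to the words `w` form paths of length `n` for `r` that start at `root`, and
the first `j` steps depend on the first `j` letters only. -/
structure IsResponse {α : Type*} (r : α → α → Prop) (root : α) (n : ℕ)
    (a : (ℕ → Bool) → ℕ → α) : Prop where
  zero : ∀ w, a w 0 = root
  step : ∀ w j, j < n → r (a w j) (a w (j + 1))
  causal : ∀ w w' j, j ≤ n → (∀ i < j, w i = w' i) → a w j = a w' j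

namespace IsResponse

variable {α : Type*} {r : α → α → Prop} {root : α} {n : ℕ} {a : (ℕ → Bool) → ℕ → α}

theorem stepsTo (ha : IsResponse r root n a) (w : ℕ → Bool) (h j : ℕ) (hj : j + h = n) :
    StepsTo r h (a w j) (a w n) := by
  induction h generalizing j with
  | zero => rw [← hj]; rfl
  | succ h ih => exact ⟨_, ha.step w j (by omega), ih (j + 1) (by omega)⟩

theorem stepsTo_flip (ha : IsResponse r root n a) (w : ℕ → Bool) (h j : ℕ) (hj : j + h ≤ n) :
    StepsTo (flip r) h (a w (j + h)) (a w j) := by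
  induction h with
  | zero => rfl
  | succ h ih => exact ⟨_, ha.step w (j + h) (by omega), ih (by omega)⟩

/-- Lexicographic traversal of the words with a given prefix `u` of length `j`: first those starting
with `u 0`, then one jump from `u 0 1^h` to `u 1 0^h`, then those starting with `u 1`. -/
theorem reflTransGen (ha : IsResponse r root n a) {W : α × ℕ → Prop}
    (hW : ∀ w, W (a w n, wordCount n w)) (h j : ℕ) (hj : j + h = n) (w : ℕ → Bool) :
    Relation.ReflTransGen (fun o o' => (∃ k, 1 ≤ k ∧ ContourStep r k o o') ∧ W o')
      (a (wordTail w j false) n, wordCount n (wordTail w j false))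
      (a (wordTail w j true) n, wordCount n (wordTail w j true)) := by
  induction h generalizing j w with
  | zero =>
    -- With `j = n` the constant tail lies beyond the letters that matter, so both ends coincide.
    have e : ∀ b, ∀ i < n, wordTail w j b i = w i := fun b i hi => by
      simp [wordTail, show i < j by omega]
    rw [ha.causal _ _ n le_rfl (e true), ha.causal _ _ n le_rfl (e false),
      wordCount_congr (e true), wordCount_congr (e false)]
  | succ h ih =>
    have h₁ := ih (j + 1) (by omega) (wordTail w j false)
    have h₂ := ih (j + 1) (by omega) (wordTail w j true)
    rw [wordTail_wordTail] at h₁ h₂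
    refine (h₁.tail ⟨⟨h + 1, by omega, ⟨a w j, ?_, ?_⟩, ?_⟩, hW _⟩).trans h₂
    -- Both words of the jump share their first `j` letters, so by causality `a w j` is a common
    -- ancestor of the two end points.
    · have e : a w j = a (wordTail (wordTail w j false) (j + 1) true) j :=
        ha.causal _ _ _ (by omega) fun i hi => by
          simp [wordTail, show i < j by omega, show i < j + 1 by omega]
      have := ha.stepsTo_flip (wordTail (wordTail w j false) (j + 1) true) (h + 1) j (by omega)
      rw [hj] at this
      rwa [e]
    · have e : a w j = a (wordTail (wordTail w j true) (j + 1) false) j :=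
        ha.causal _ _ _ (by omega) fun i hi => by
          simp [wordTail, show i < j by omega, show i < j + 1 by omega]
      rw [e]
      exact ha.stepsTo _ _ _ hj
    · have hn : n = (j + 1) + h := by omega
      simp only
      rw [hn, wordCount_wordTail, wordCount_wordTail, wordCount_wordTail, wordCount_wordTail]
      simp only [Bool.toNat_true, Bool.toNat_false]
      omega

/-- A response whose end points all lie in `W` gives rise to a self-avoiding contour in `W`. -/
theorem exists_contour (ha : IsResponse r root n a) {W : α × ℕ → Prop}
    (hW : ∀ w, W (a w n, wordCount n w)) :
    ∃ m, n ≤ m ∧ ∃ a₀, StepsTo r n root a₀ ∧ ∃ l, WeightedPath (ContourStep r) (a₀, 0) (2 * m - n) l ∧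
      l.length = m ∧ ((a₀, 0) :: l).Nodup ∧ ∀ o ∈ (a₀, 0) :: l, W o := by
  have hcount : ∀ b, wordCount n (wordTail (fun _ => false) 0 b) = n * b.toNat := fun b => by
    have := wordCount_wordTail (fun _ => false) 0 n b
    rw [zero_add] at this
    rw [this]
    simp [wordCount]
  obtain ⟨l, hl, hlast, hnodup⟩ := exists_nodup_chain
    (ha.reflTransGen hW n 0 (zero_add n) fun _ => false)
  obtain ⟨K, hK, hle, hsum, hall⟩ := exists_weightedPath_of_isChain l _ hl
  -- The chain relation puts only the targets of steps in `W`; the starting point needs a separate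
  -- argument.
  have h₀ := hW (wordTail (fun _ => false) 0 false)
  rw [hlast, hcount, hcount] at hsum
  simp only [Bool.toNat_true, Bool.toNat_false, mul_one, mul_zero] at hsum
  rw [hcount] at hK hnodup h₀
  simp only [Bool.toNat_false, mul_zero] at hK hnodup h₀
  have hKe : K = 2 * l.length - n := by omega
  refine ⟨l.length, by omega, _, ?_, l, hKe ▸ hK, rfl, hnodup, ?_⟩
  · have := ha.stepsTo (wordTail (fun _ => false) 0 false) n 0 (zero_add n)
    rwa [ha.zero] at this
  · simp only [List.mem_cons, forall_eq_or_imp]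
    exact ⟨h₀, hall⟩

/-- The self-avoiding contours with `m` steps are at most `(4 * d) ^ (2 * m)` many. -/
theorem exists_finset_contours {d : ℕ} (hd : 1 ≤ d) (hr : OutBounded r 2)
    (hr' : OutBounded (flip r) d) (root : α) {n m : ℕ} (hnm : n ≤ m) :
    ∃ T : Finset (List (α × ℕ)), T.card ≤ (4 * d) ^ (2 * m) ∧
      (∀ L ∈ T, L.Nodup ∧ L.length = m + 1) ∧
      ∀ a₀ l, StepsTo r n root a₀ → WeightedPath (ContourStep r) (a₀, 0) (2 * m - n) l →
        l.length = m → ((a₀, 0) :: l).Nodup → (a₀, 0) :: l ∈ T := by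
  classical
  obtain ⟨S, hS, hS'⟩ := (hr.stepsTo n) root
  choose T hT hT' using fun a₀ => WeightedPath.exists_finset
    (outBounded_contourStep hr hr') (2 * m - n) (a₀, 0)
  -- The filter discards paths of the right weight that are not self-avoiding or have the wrong
  -- length, for which the probability bound could fail.
  refine ⟨{L ∈ S.biUnion fun a₀ => (T a₀).image (List.cons (a₀, 0)) |
    L.Nodup ∧ L.length = m + 1}, ?_, ?_, ?_⟩
  · calc _ ≤ (S.biUnion fun a₀ => (T a₀).image (List.cons (a₀, 0))).card :=
          Finset.card_filter_le _ _
      _ ≤ 2 ^ n * (2 * (d * 2)) ^ (2 * m - n) :=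
          (Finset.card_biUnion_le_card_mul _ _ _ fun a₀ _ =>
            Finset.card_image_le.trans (hT a₀)).trans (Nat.mul_le_mul_right _ hS)
      -- The `2 ^ n` starting points are bounded crudely, so that the base becomes uniform.
      _ ≤ (4 * d) ^ n * (4 * d) ^ (2 * m - n) := by
          rw [show 2 * (d * 2) = 4 * d by ring]
          exact Nat.mul_le_mul_right _ (Nat.pow_le_pow_left (by omega) _)
      _ = (4 * d) ^ (2 * m) := by rw [← pow_add]; congr 1; omega
  · intro L hL
    exact (Finset.mem_filter.1 hL).2
  · intro a₀ l h₀ hl hlen hnodup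
    refine Finset.mem_filter.2 ⟨Finset.mem_biUnion.2 ⟨a₀, hS' _ h₀,
      Finset.mem_image_of_mem _ (hT' _ _ hl)⟩, hnodup, by simp [hlen]⟩

end IsResponse

/-- Peierls bound: if any `j` given points lie in the random set `W` with probability at most
`q ^ j`, then the probability that the end points of some response all lie in `W` is bounded by
a sum over contours. -/
theorem measure_exists_isResponse_le {α Ω : Type*} [MeasurableSpace Ω] (μ : Measure Ω)
    {r : α → α → Prop} {d : ℕ} (hd : 1 ≤ d) (hr : OutBounded r 2) (hr' : OutBounded (flip r) d)
    (root : α) (n : ℕ) (W : Ω → α × ℕ → Prop) (q : ℝ≥0∞)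
    (hq : ∀ L : List (α × ℕ), L.Nodup → μ {ω | ∀ o ∈ L, W ω o} ≤ q ^ L.length) :
    μ {ω | ∃ a, IsResponse r root n a ∧ ∀ w, W ω (a w n, wordCount n w)} ≤
      ∑' m : {m : ℕ // n ≤ m}, (4 * d) ^ (2 * m.1) * q ^ (m.1 + 1) := by
  choose T hT hT' hT'' using fun m : {m : ℕ // n ≤ m} =>
    IsResponse.exists_finset_contours hd hr hr' root m.2
  calc _ ≤ μ (⋃ m, ⋃ L ∈ T m, {ω | ∀ o ∈ L, W ω o}) := by
        refine measure_mono ?_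
        rintro ω ⟨a, ha, hW⟩
        obtain ⟨m, hm, a₀, h₀, l, hl, hlen, hnodup, hall⟩ := ha.exists_contour hW
        exact Set.mem_iUnion.2 ⟨⟨m, hm⟩, Set.mem_biUnion (hT'' ⟨m, hm⟩ a₀ l h₀ hl hlen hnodup) hall⟩
    _ ≤ ∑' m, μ (⋃ L ∈ T m, {ω | ∀ o ∈ L, W ω o}) := measure_iUnion_le _
    _ ≤ _ := by
        refine ENNReal.tsum_le_tsum fun m => ?_
        calc _ ≤ ∑ L ∈ T m, μ {ω | ∀ o ∈ L, W ω o} := measure_biUnion_finset_le _ _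
          _ ≤ ∑ L ∈ T m, q ^ (m.1 + 1) := Finset.sum_le_sum fun L hL => by
              obtain ⟨h₁, h₂⟩ := hT' m L hL
              rw [← h₂]
              exact hq L h₁
          _ = (T m).card * q ^ (m.1 + 1) := by rw [Finset.sum_const, nsmul_eq_mul]
          _ ≤ _ := by
              gcongr
              exact_mod_cast hT m

/-! ### Alternating games in which the first player's move counts are recorded -/

/-- The move counts after playing a further move. -/
def letterMove (b : Bool) (x : ℕ × ℕ) : ℕ × ℕ := if b then (x.1, x.2 + 1) else (x.1 + 1, x.2)

theorem quadrant_edge_letterMove (b : Bool) (x : ℕ × ℕ) :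
    DecisionGraph.quadrant.Edge x (letterMove b x) := by
  cases b
  · exact Or.inl rfl
  · exact Or.inr rfl

theorem letterMove_snd (b : Bool) (x : ℕ × ℕ) : (letterMove b x).2 = x.2 + b.toNat := by
  cases b <;> rfl

namespace GameGraph

variable {G : GameGraph} (σ₁ : G.Strategy .alice) (σ₂ : G.Strategy .bob) (v : G.V)

theorem next_of_alice (hv : G.NonFinal v ∧ G.turn v = .alice) :
    G.next σ₁ σ₂ v = (σ₁ ⟨v, hv⟩).1 := dif_pos hv

theorem next_of_bob (hv : G.NonFinal v ∧ G.turn v = .bob) :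
    G.next σ₁ σ₂ v = (σ₂ ⟨v, hv⟩).1 :=
  (dif_neg (by rw [hv.2]; simp)).trans (dif_pos hv)

end GameGraph

namespace DecisionGraph

/-- `E` is a game graph in which moves in `quadrant` and moves in `D` alternate, those in `quadrant`
coming first; `α` and `β` are the projections to `D` and to `quadrant`. -/
structure IsAlternation (E D : DecisionGraph) (α : E.V → D.V) (β : E.V → ℕ × ℕ) : Prop where
  injective : ∀ v w, α v = α w → β v = β w → v = w
  alpha_root : α E.root = D.root
  beta_root : β E.root = (0, 0)
  beta_level : ∀ v, (β v).1 + (β v).2 = (E.level v + 1) / 2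
  alpha_even : ∀ v w, Even (E.level v) → E.Edge v w → α w = α v
  edge_odd : ∀ v w, ¬ Even (E.level v) → E.Edge v w → D.Edge (α v) (α w) ∧ β w = β v
  exists_move : ∀ v b, Even (E.level v) → quadrant.Edge (β v) b → ∃ w, E.Edge v w ∧ β w = b

theorem isAlternation_ltimes (D : DecisionGraph) :
    IsAlternation (quadrant.ltimes D) D (fun v => v.1.2) (fun v => v.1.1) where
  injective v w h₁ h₂ := Subtype.ext (Prod.ext h₂ h₁)
  alpha_root := rfl
  beta_root := rfl
  beta_level v := by
    change quadrant.level v.1.1 = (quadrant.level v.1.1 + D.level v.1.2 + 1) / 2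
    have := v.2
    omega
  alpha_even := by
    rintro v w hv (⟨_, _, h⟩ | ⟨h, _, _⟩)
    · exact h
    · change Even (quadrant.level v.1.1 + D.level v.1.2) at hv
      rw [h] at hv
      obtain ⟨k, hk⟩ := hv
      omega
  edge_odd := by
    rintro v w hv (⟨h, _, _⟩ | ⟨_, h, h'⟩)
    · change ¬ Even (quadrant.level v.1.1 + D.level v.1.2) at hv
      rw [h] at hv
      exact absurd ⟨_, rfl⟩ hv
    · exact ⟨h', h⟩
  exists_move := by
    rintro ⟨⟨x, a⟩, hv⟩ b hev hb
    have hev : Even (quadrant.level x + D.level a) := hev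
    have hx : quadrant.level x = D.level a := by
      obtain ⟨k, hk⟩ := hev
      simp only at hv
      omega
    exact ⟨⟨(b, a), Or.inr (by rw [quadrant.level_edge hb]; exact congrArg (· + 1) hx)⟩,
      Or.inl ⟨hx, hb, rfl⟩, rfl⟩

/-- The structure is carried over from `quadrant.ltimes D` by swapping coordinates. -/
theorem isAlternation_rtimes (D : DecisionGraph) :
    IsAlternation (D.rtimes quadrant) D (fun v => v.1.1) (fun v => v.1.2) where
  injective v w h₁ h₂ := Subtype.ext (Prod.ext h₁ h₂)
  alpha_root := rfl
  beta_root := rfl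
  beta_level v := (isAlternation_ltimes D).beta_level ⟨v.1.swap, v.2⟩
  alpha_even v w := (isAlternation_ltimes D).alpha_even ⟨v.1.swap, v.2⟩ ⟨w.1.swap, w.2⟩
  edge_odd v w := (isAlternation_ltimes D).edge_odd ⟨v.1.swap, v.2⟩ ⟨w.1.swap, w.2⟩
  exists_move v b hv hb := by
    obtain ⟨w, hw, hwb⟩ := (isAlternation_ltimes D).exists_move ⟨v.1.swap, v.2⟩ b hv hb
    exact ⟨⟨w.1.swap, w.2⟩, hw, hwb⟩

/-! ### Plays of games on decision graphs -/

theorem nonFinal_game_iff (E : DecisionGraph) (first : Player) (N : ℕ)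
    (v : (E.game first N).V) : (E.game first N).NonFinal v ↔ E.level v.1 < N := by
  constructor
  · rintro ⟨w, hw⟩
    have h₁ := E.level_edge hw
    have h₂ := w.2
    omega
  · intro h
    obtain ⟨w, hw⟩ := E.exists_edge v.1
    exact ⟨⟨w, by rw [E.level_edge hw]; omega⟩, hw⟩

section Play

variable {E : DecisionGraph} {first : Player} {N : ℕ} (σ₁ : (E.game first N).Strategy .alice)
  (σ₂ : (E.game first N).Strategy .bob)

theorem level_play (k : ℕ) (hk : k ≤ N) : E.level ((E.game first N).play σ₁ σ₂ k).1 = k := by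
  induction k with
  | zero => exact E.level_root
  | succ k ih =>
    have ih := ih (by omega)
    have := (E.game first N).edge_next σ₁ σ₂ ((E.game first N).play σ₁ σ₂ k)
      ((nonFinal_game_iff E first N _).2 (by omega))
    exact (E.level_edge this).trans (by rw [ih])

theorem edge_play (k : ℕ) (hk : k < N) : E.Edge ((E.game first N).play σ₁ σ₂ k).1
    ((E.game first N).play σ₁ σ₂ (k + 1)).1 :=
  (E.game first N).edge_next σ₁ σ₂ _
    ((nonFinal_game_iff E first N _).2 (by rw [level_play σ₁ σ₂ k hk.le]; exact hk))

theorem outcome_game :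
    ((E.game first N).outcome σ₁ σ₂).1.1 = ((E.game first N).play σ₁ σ₂ N).1 := by
  classical
  have : Nat.find ((E.game first N).exists_play_final σ₁ σ₂) = N := by
    rw [Nat.find_eq_iff]
    refine ⟨?_, fun k hk => not_not.2 ?_⟩
    · rw [nonFinal_game_iff, level_play σ₁ σ₂ N le_rfl]
      omega
    · rw [nonFinal_game_iff, level_play σ₁ σ₂ k hk.le]
      exact hk
  change ((E.game first N).play σ₁ σ₂ (Nat.find _)).1 = _
  rw [← congrArg ((E.game first N).play σ₁ σ₂) this]

end Play

/-! ### Winning strategies as responses -/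

namespace IsAlternation

variable {E D : DecisionGraph} {α : E.V → D.V} {β : E.V → ℕ × ℕ}

/-- After `2 * j` moves each player has moved `j` times, so sampling the play at even times records
the responder's path. The strategies are indexed by words, and `hcausal` lets letter `i` influence
only the move at level `2 * i`. -/
theorem isResponse_play (hE : IsAlternation E D α β) {first : Player} {n : ℕ}
    (σ₁ : (ℕ → Bool) → (E.game first (2 * n)).Strategy .alice)
    (σ₂ : (ℕ → Bool) → (E.game first (2 * n)).Strategy .bob)
    (hcausal : ∀ w w' v, (Even (E.level v.1) → w (E.level v.1 / 2) = w' (E.level v.1 / 2)) →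
      (E.game first (2 * n)).next (σ₁ w) (σ₂ w) v = (E.game first (2 * n)).next (σ₁ w') (σ₂ w') v)
    (hmove : ∀ w v, E.level v.1 < 2 * n → Even (E.level v.1) →
      β ((E.game first (2 * n)).next (σ₁ w) (σ₂ w) v).1 =
        letterMove (w (E.level v.1 / 2)) (β v.1)) :
    IsResponse D.Edge D.root n
      (fun w j => α ((E.game first (2 * n)).play (σ₁ w) (σ₂ w) (2 * j)).1) ∧
    ∀ w, (β ((E.game first (2 * n)).play (σ₁ w) (σ₂ w) (2 * n)).1).2 = wordCount n w := by
  have hlev w k (hk : k ≤ 2 * n) := level_play (σ₁ w) (σ₂ w) k hk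
  have hedge w k (hk : k < 2 * n) := edge_play (σ₁ w) (σ₂ w) k hk
  have hodd : ∀ w j, j < n → ¬ Even (E.level
      ((E.game first (2 * n)).play (σ₁ w) (σ₂ w) (2 * j + 1)).1) := fun w j hj => by
    rw [hlev w _ (by omega)]
    simp
  refine ⟨⟨fun w => hE.alpha_root, fun w j hj => ?_, fun w w' j hj hw => ?_⟩, fun w => ?_⟩
  · have h₁ := hE.alpha_even _ _ (by rw [hlev w _ (by omega)]; simp) (hedge w (2 * j) (by omega))
    have h₂ := (hE.edge_odd _ _ (hodd w j hj) (hedge w (2 * j + 1) (by omega))).1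
    rw [h₁] at h₂
    exact h₂
  · have key : ∀ k ≤ 2 * j, (E.game first (2 * n)).play (σ₁ w) (σ₂ w) k =
        (E.game first (2 * n)).play (σ₁ w') (σ₂ w') k := by
      intro k hk
      induction k with
      | zero => rfl
      | succ k ih =>
        have ih := ih (by omega)
        simp only [GameGraph.play]
        rw [← ih]
        refine hcausal _ _ _ fun _ => ?_
        rw [hlev w k (by omega)]
        exact hw _ (by omega)
    exact congrArg (fun v => α v.1) (key _ le_rfl)
  · have key : ∀ j ≤ n, (β ((E.game first (2 * n)).play (σ₁ w) (σ₂ w) (2 * j)).1).2 =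
        wordCount j w := by
      intro j hj
      induction j with
      | zero => exact congrArg Prod.snd hE.beta_root
      | succ j ih =>
        have h₁ := hmove w ((E.game first (2 * n)).play (σ₁ w) (σ₂ w) (2 * j))
          (by rw [hlev w _ (by omega)]; omega) (by rw [hlev w _ (by omega)]; simp)
        have h₂ := (hE.edge_odd _ _ (hodd w j hj) (hedge w (2 * j + 1) (by omega))).2
        rw [hlev w _ (by omega), Nat.mul_div_cancel_left _ two_pos] at h₁
        rw [wordCount_succ, ← ih (by omega), ← letterMove_snd, ← h₁]
        exact congrArg Prod.snd h₂
    exact key n le_rfl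

theorem exists_move_game (hE : IsAlternation E D α β) (first : Player) (N : ℕ) (b : Bool)
    (v : {v : (E.game first N).V // (E.game first N).NonFinal v ∧ (E.game first N).turn v = first}) :
    ∃ w : {w : (E.game first N).V // (E.game first N).Edge v.1 w},
      β w.1.1 = letterMove b (β v.1.1) := by
  have hev : Even (E.level v.1.1) := by
    have h := v.2.2
    simp only [game] at h
    by_contra hcon
    rw [if_neg hcon] at h
    cases first <;> cases h
  have hlt := (nonFinal_game_iff E first N _).1 v.2.1
  obtain ⟨w, hw, hwb⟩ := hE.exists_move v.1.1 _ hev (quadrant_edge_letterMove b _)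
  exact ⟨⟨⟨w, by rw [E.level_edge hw]; omega⟩, hw⟩, hwb⟩

theorem exists_isResponse_of_aliceWins (hE : IsAlternation E D α β) {n : ℕ}
    {x : (E.game .bob (2 * n)).Outcome → Bool} (hx : (E.game .bob (2 * n)).AliceWins x) :
    ∃ a, IsResponse D.Edge D.root n a ∧ ∀ w, ∃ v : (E.game .bob (2 * n)).Outcome,
      (α v.1.1, (β v.1.1).2) = (a w n, wordCount n w) ∧ x v = false := by
  obtain ⟨σ, hσ⟩ := hx
  choose mv hmv using hE.exists_move_game .bob (2 * n)
  -- Bob plays letter `i` in his move at level `2 * i`, whatever the state; since the level is a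
  -- function of the state, this is a legitimate strategy.
  have h := hE.isResponse_play (first := .bob) (n := n) (fun _ => σ)
    (fun w v => mv (w (E.level v.1.1 / 2)) v) ?_ ?_
  · obtain ⟨h₁, h₂⟩ := h
    refine ⟨_, h₁, fun w => ⟨_, Prod.ext ?_ ?_, hσ (fun v => mv (w (E.level v.1.1 / 2)) v)⟩⟩
    · exact congrArg α (outcome_game _ _)
    · exact (congrArg (fun v => (β v).2) (outcome_game _ _)).trans (h₂ w)
  · intro w w' v h
    simp only [GameGraph.next]
    split_ifs with ha hb
    · rfl
    · have hev : Even (E.level v.1) := by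
        by_contra hcon
        have := hb.2
        simp only [game] at this
        rw [if_neg hcon] at this
        cases this
      rw [h hev]
    · rfl
  · intro w v hv hev
    have ht : (E.game .bob (2 * n)).turn v = .bob := if_pos hev
    have hnf := (nonFinal_game_iff E .bob (2 * n) v).2 hv
    exact (congrArg (fun u => β u.1) (GameGraph.next_of_bob (G := E.game .bob (2 * n)) σ
      (fun v => mv (w (E.level v.1.1 / 2)) v) v ⟨hnf, ht⟩)).trans (hmv _ _)

/-- The same argument with the roles exchanged: Alice plays the words and Bob responds. -/
theorem exists_isResponse_of_bobWins (hE : IsAlternation E D α β) {n : ℕ}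
    {x : (E.game .alice (2 * n)).Outcome → Bool} (hx : (E.game .alice (2 * n)).BobWins x) :
    ∃ a, IsResponse D.Edge D.root n a ∧ ∀ w, ∃ v : (E.game .alice (2 * n)).Outcome,
      (α v.1.1, (β v.1.1).2) = (a w n, wordCount n w) ∧ x v = true := by
  obtain ⟨σ, hσ⟩ := hx
  choose mv hmv using hE.exists_move_game .alice (2 * n)
  have h := hE.isResponse_play (first := .alice) (n := n)
    (fun w v => mv (w (E.level v.1.1 / 2)) v) (fun _ => σ) ?_ ?_
  · obtain ⟨h₁, h₂⟩ := h
    refine ⟨_, h₁, fun w => ⟨_, Prod.ext ?_ ?_, hσ (fun v => mv (w (E.level v.1.1 / 2)) v)⟩⟩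
    · exact congrArg α (outcome_game _ _)
    · exact (congrArg (fun v => (β v).2) (outcome_game _ _)).trans (h₂ w)
  · intro w w' v h
    simp only [GameGraph.next]
    split_ifs with ha hb
    · have hev : Even (E.level v.1) := by
        by_contra hcon
        have := ha.2
        simp only [game] at this
        rw [if_neg hcon] at this
        cases this
      rw [h hev]
    · rfl
    · rfl
  · intro w v hv hev
    have ht : (E.game .alice (2 * n)).turn v = .alice := if_pos hev
    have hnf := (nonFinal_game_iff E .alice (2 * n) v).2 hv
    exact (congrArg (fun u => β u.1) (GameGraph.next_of_alice (G := E.game .alice (2 * n))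
      (fun v => mv (w (E.level v.1.1 / 2)) v) σ v ⟨hnf, ht⟩)).trans (hmv _ _)

/-- In an outcome the first player's total number of moves is known, so one count determines the
other. -/
theorem injective_outcome (hE : IsAlternation E D α β) (first : Player) (N : ℕ) :
    Function.Injective fun v : (E.game first N).Outcome => (α v.1.1, (β v.1.1).2) := by
  intro v w h
  obtain ⟨h₁, h₂⟩ := Prod.ext_iff.1 h
  have hlev : ∀ u : (E.game first N).Outcome, E.level u.1.1 = N := fun u => by
    have := u.2
    rw [nonFinal_game_iff] at this
    have := u.1.2
    omega
  have hv := hE.beta_level v.1.1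
  have hw := hE.beta_level w.1.1
  rw [hlev] at hv hw
  simp only at h₂
  exact Subtype.ext (Subtype.ext (hE.injective _ _ h₁ (Prod.ext (by omega) h₂)))

end IsAlternation

end DecisionGraph

/-! ### Probability estimates -/

/-- Distinct points label distinct outcomes, whose winners are independent. The points of `L` need
not all be labels: a contour is counted as an abstract path, and one with a point that labels no
outcome has probability zero. -/
theorem GameGraph.winnerLaw_forall_mem_le (G : GameGraph) (p : unitInterval) {γ : Type*}
    {e : G.Outcome → γ} (he : Function.Injective e) (b : Bool) (L : List γ) (hL : L.Nodup) :
    G.winnerLaw p {x | ∀ o ∈ L, ∃ v, e v = o ∧ x v = b} ≤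
      ProbabilityTheory.bernoulliMeasure true false p {b} ^ L.length := by
  classical
  by_cases hrange : ∀ o ∈ L, ∃ v, e v = o
  · have hcard : L.length = (Finset.univ.filter fun v => e v ∈ L).card := by
      rw [← List.toFinset_card_of_nodup hL, ← Finset.card_image_of_injective _ he]
      congr 1
      ext o
      simp only [List.mem_toFinset, Finset.mem_image, Finset.mem_filter, Finset.mem_univ, true_and]
      constructor
      · intro ho
        obtain ⟨v, rfl⟩ := hrange o ho
        exact ⟨v, ho, rfl⟩
      · rintro ⟨v, hv, rfl⟩
        exact hv
    calc _ ≤ G.winnerLaw p (Set.univ.pi fun v => if e v ∈ L then {b} else Set.univ) := by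
          refine measure_mono fun x hx v _ => ?_
          beta_reduce
          split_ifs with hv
          · obtain ⟨v', hv', hx'⟩ := hx _ hv
            rw [he hv'] at hx'
            exact hx'
          · trivial
      _ = _ := by
          rw [winnerLaw, Measure.pi_pi, hcard, ← Finset.prod_const, Finset.prod_filter]
          refine Finset.prod_congr rfl fun v _ => ?_
          split_ifs
          · rfl
          · exact measure_univ
  · push Not at hrange
    obtain ⟨o, ho, hno⟩ := hrange
    have : {x : G.Outcome → Bool | ∀ o ∈ L, ∃ v, e v = o ∧ x v = b} = ∅ := by
      ext x
      simp only [Set.mem_ofPred_eq, Set.mem_empty_iff_false, iff_false]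
      intro h
      obtain ⟨v, hv, _⟩ := h o ho
      exact hno v hv
    rw [this, measure_empty]
    exact zero_le

theorem bernoulliMeasure_singleton_true (p : unitInterval) :
    ProbabilityTheory.bernoulliMeasure true false p {true} = ENNReal.ofReal (p : ℝ) := by
  rw [ProbabilityTheory.bernoulliMeasure_apply_of_mem_of_notMem p (by simp) (by simp) (by simp),
    ENNReal.ofReal, Real.toNNReal_of_nonneg p.2.1]
  rfl

theorem bernoulliMeasure_singleton_false (p : unitInterval) :
    ProbabilityTheory.bernoulliMeasure true false p {false} = ENNReal.ofReal (1 - (p : ℝ)) := by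
  rw [ProbabilityTheory.bernoulliMeasure_apply_of_notMem_of_mem p (by simp) (by simp) (by simp),
    ENNReal.ofReal, Real.toNNReal_of_nonneg (sub_nonneg.2 p.2.2)]
  rfl

namespace DecisionGraph

variable {E D : DecisionGraph} {α : E.V → D.V} {β : E.V → ℕ × ℕ} {d : ℕ}

theorem IsAlternation.probAlice_le (hE : IsAlternation E D α β) (hd : 1 ≤ d)
    (hr : OutBounded D.Edge 2) (hr' : OutBounded (flip D.Edge) d) (n : ℕ) (p : unitInterval) :
    (E.game .bob (2 * n)).probAlice p ≤
      ∑' m : {m : ℕ // n ≤ m}, (4 * d) ^ (2 * m.1) * ENNReal.ofReal (1 - (p : ℝ)) ^ (m.1 + 1) := by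
  rw [← bernoulliMeasure_singleton_false]
  exact (measure_mono fun x hx => hE.exists_isResponse_of_aliceWins hx).trans
    (measure_exists_isResponse_le _ hd hr hr' D.root n _ _ fun L hL =>
      GameGraph.winnerLaw_forall_mem_le _ p (hE.injective_outcome .bob (2 * n)) false L hL)

theorem IsAlternation.probBob_le (hE : IsAlternation E D α β) (hd : 1 ≤ d)
    (hr : OutBounded D.Edge 2) (hr' : OutBounded (flip D.Edge) d) (n : ℕ) (p : unitInterval) :
    (E.game .alice (2 * n)).probBob p ≤
      ∑' m : {m : ℕ // n ≤ m}, (4 * d) ^ (2 * m.1) * ENNReal.ofReal (p : ℝ) ^ (m.1 + 1) := by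
  rw [← bernoulliMeasure_singleton_true]
  exact (measure_mono fun x hx => hE.exists_isResponse_of_bobWins hx).trans
    (measure_exists_isResponse_le _ hd hr hr' D.root n _ _ fun L hL =>
      GameGraph.winnerLaw_forall_mem_le _ p (hE.injective_outcome .alice (2 * n)) true L hL)

/-! ### Degrees in the tree and the quadrant -/

theorem outBounded_tree : OutBounded tree.Edge 2 := by
  suffices OutBounded (fun v w : List (Fin 2) => ∃ k : Fin 2, w = v ++ [k]) 2 from this
  intro v
  refine ⟨Finset.univ.image fun k : Fin 2 => v ++ [k], Finset.card_image_le.trans (by simp), ?_⟩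
  rintro w ⟨k, rfl⟩
  exact Finset.mem_image_of_mem _ (Finset.mem_univ k)

theorem outBounded_flip_tree : OutBounded (flip tree.Edge) 1 := by
  suffices OutBounded (fun w v : List (Fin 2) => ∃ k : Fin 2, w = v ++ [k]) 1 from this
  intro w
  refine ⟨{w.dropLast}, by simp, ?_⟩
  rintro v ⟨k, rfl⟩
  simp

theorem outBounded_quadrant : OutBounded quadrant.Edge 2 := by
  suffices OutBounded (fun v w : ℕ × ℕ => w = (v.1 + 1, v.2) ∨ w = (v.1, v.2 + 1)) 2 from this
  refine fun v => ⟨{(v.1 + 1, v.2), (v.1, v.2 + 1)}, Finset.card_le_two, ?_⟩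
  rintro w (rfl | rfl) <;> simp

theorem outBounded_flip_quadrant : OutBounded (flip quadrant.Edge) 2 := by
  suffices OutBounded (fun w v : ℕ × ℕ => w = (v.1 + 1, v.2) ∨ w = (v.1, v.2 + 1)) 2 from this
  refine fun w => ⟨{(w.1 - 1, w.2), (w.1, w.2 - 1)}, Finset.card_le_two, ?_⟩
  rintro v (rfl | rfl) <;> simp

end DecisionGraph

/-! ### Convergence of the contour series and conclusion -/

theorem tendsto_tsum_contour_zero {c q : ℝ≥0∞} (hq : q ≠ ∞) (hc : c * q < 1) :
    Tendsto (fun n : ℕ => ∑' m : {m : ℕ // n ≤ m}, c ^ m.1 * q ^ (m.1 + 1)) atTop (𝓝 0) := by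
  have hsum : ∑' m : ℕ, c ^ m * q ^ (m + 1) ≠ ∞ := by
    have : ∀ m : ℕ, c ^ m * q ^ (m + 1) = (c * q) ^ m * q := fun m => by ring
    simp only [this]
    rw [ENNReal.tsum_mul_right, ENNReal.tsum_geometric]
    exact ENNReal.mul_ne_top (ENNReal.inv_ne_top.2 (tsub_pos_iff_lt.2 hc).ne') hq
  refine (ENNReal.tendsto_sum_nat_add _ hsum).congr fun n => ?_
  -- The shift by `n` identifies the series with a tail of the geometric series.
  let e : ℕ ≃ {m : ℕ // n ≤ m} :=
    ⟨fun k => ⟨k + n, by omega⟩, fun m => m.1 - n, fun k => by simp,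
      fun m => Subtype.ext (Nat.sub_add_cancel m.2)⟩
  exact e.tsum_eq fun m : {m : ℕ // n ≤ m} => c ^ m.1 * q ^ (m.1 + 1)

theorem natCast_mul_ofReal_lt_one {c : ℕ} (hc : 0 < c) {x : ℝ} (hx : x < 1 / c) :
    (c : ℝ≥0∞) * ENNReal.ofReal x < 1 := by
  rw [← ENNReal.ofReal_natCast, ← ENNReal.ofReal_mul (Nat.cast_nonneg c), ENNReal.ofReal_lt_one]
  rw [lt_div_iff₀ (by exact_mod_cast hc)] at hx
  linarith

open DecisionGraph in
theorem proposition2p8 :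
    (∀ n : ℕ, 1 ≤ n → ∀ p : unitInterval,
      (game_Ab' n).probAlice p ≤
        ∑' m : {m : ℕ // n ≤ m}, 2 ^ (4 * m.1) * ENNReal.ofReal (1 - (p : ℝ)) ^ (m.1 + 1) ∧
      (game_ab' n).probAlice p ≤
        ∑' m : {m : ℕ // n ≤ m}, 2 ^ (6 * m.1) * ENNReal.ofReal (1 - (p : ℝ)) ^ (m.1 + 1)) ∧
    (∀ p : unitInterval, (p : ℝ) < 1 / 16 →
      Tendsto (fun n => (game_aB n).probBob p) atTop (𝓝 0)) ∧
    (∀ p : unitInterval, (p : ℝ) < 1 / 64 →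
      Tendsto (fun n => (game_ab n).probBob p) atTop (𝓝 0)) := by
  -- The casts `1` and `2` are the in-degree bounds `d` of the tree and the quadrant.
  have e₁ : ∀ m : ℕ, (4 * ((1 : ℕ) : ℝ≥0∞)) ^ (2 * m) = 2 ^ (4 * m) := fun m => by
    rw [pow_mul, pow_mul]; norm_num
  have e₂ : ∀ m : ℕ, (4 * ((2 : ℕ) : ℝ≥0∞)) ^ (2 * m) = 2 ^ (6 * m) := fun m => by
    rw [pow_mul, pow_mul]; norm_num
  refine ⟨fun n _ p => ⟨?_, ?_⟩, fun p hp => ?_, fun p hp => ?_⟩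
  · have := (isAlternation_rtimes tree).probAlice_le le_rfl outBounded_tree
      outBounded_flip_tree n p
    simp only [e₁] at this
    exact this
  · have := (isAlternation_rtimes quadrant).probAlice_le one_le_two outBounded_quadrant
      outBounded_flip_quadrant n p
    simp only [e₂] at this
    exact this
  · have hlim := tendsto_tsum_contour_zero ENNReal.ofReal_ne_top
      (natCast_mul_ofReal_lt_one (c := 16) (by norm_num) (x := p) (by exact_mod_cast hp))
    refine tendsto_of_tendsto_of_tendsto_of_le_of_le tendsto_const_nhds hlim
      (fun n => zero_le) fun n => ?_
    have := (isAlternation_ltimes tree).probBob_le le_rfl outBounded_tree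
      outBounded_flip_tree n p
    refine this.trans_eq (tsum_congr fun m => ?_)
    rw [pow_mul]
    norm_num
  · have hlim := tendsto_tsum_contour_zero ENNReal.ofReal_ne_top
      (natCast_mul_ofReal_lt_one (c := 64) (by norm_num) (x := p) (by exact_mod_cast hp))
    refine tendsto_of_tendsto_of_tendsto_of_le_of_le tendsto_const_nhds hlim
      (fun n => zero_le) fun n => ?_
    have := (isAlternation_ltimes quadrant).probBob_le one_le_two outBounded_quadrant
      outBounded_flip_quadrant n p
    refine this.trans_eq (tsum_congr fun m => ?_)
    rw [pow_mul]
    norm_num
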